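/- **Setting.** There are arms $1,\dots,A$ and objectives $1,\dots,D$. In each round $t=1,2,\dots$ the learner selects an arm $a(t)$ and observes the rewards $r^i(t)=\mu^i_{a(t)}+\kappa^i(t)$, $1\le i\le D$. Given the past and $a(t)=a$, the noise vector $(\kappa^1(t),\dots,\kappa^D(t))$ has a fixed distribution $\nu_a$ (independent of the other rounds; the noise may be dependent over the objectives) whose marginals have mean zero and are $1$-sub-Gaussian: $\mathbb E[e^{\lambda\kappa^i(t)}\mid a(t)=a]\le e^{\lambda^2/2}$ for all $\lambda\in\mathbb R$. The vector $\mu\in\mathbb R^D$ lexicographically dominates $\mu'$ if $\mu^j>\mu'^j$ for the first $j$ with $\mu^j\ne\mu'^j$. Let $*$ be a lexicographic optimal arm, i.e. $(\mu_*^1,\dots,\mu_*^D)$ is not lexicographically dominated by the mean vector of any arm. Put $$\Delta_a^i=\mu_*^i-\mu_a^i,\qquad \mathcal S^i=\{a:\Delta_a^i>0\},\qquad \Delta_{\min}^i=\min_{a\in\mathcal S^i}\Delta_a^i\quad(=\infty\text{ if }\mathcal S^i=\emptyset).$$ The learner knows $\eta_1,\dots,\eta_D$ such that $\mu_*^i-\Delta_{\min}^i<\eta_i<\mu_*^i$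 for all $i$ (Case 2), and $\delta_i=\mu_*^i-\eta_i$. **NOM-LEX.** Let $N_a(t)$ be the number of rounds before $t$ in which arm $a$ was selected and $\hat\mu_a^i(t)$ the sample mean of the shifted rewards $r^i(s)-\eta_i$ over these rounds. (Equivalently one may assume $\eta_i=0$ for all $i$.) In rounds $t=1,\dots,A$ select arm $t$. Afterwards, at a round $t$ with no sweep under way, let $$\hat{\mathcal A}_*(t)=\Big\{a:\ \hat\mu_a^i(t)>-\sqrt{\tfrac{4\log N_a(t)}{N_a(t)}}\ \text{ for all } i=1,\dots,D\Big\};$$ if $\hat{\mathcal A}_*(t)\ne\emptyset$, select $a(t)\in\hat{\mathcal A}_*(t)$ uniformly at random; if $\hat{\mathcal A}_*(t)=\emptyset$, make a sweep through all arms, that is, select $a(t)=1,a(t+1)=2,\dots,a(t+A-1)=A$. **Theorem.** Let $\mathrm{Reg}^i_{pf}(T)=\sum_{t=1}^T\Delta^i_{a(t)}$ be the priority-free regret in objective $i$ when NOM-LEX is run in this setting. Then for all $i\in\{1,\dots,D\}$ and all $T\ge1$, $$\mathbb E[\mathrm{Reg}^i_{pf}(T)]\le\sum_{a\in\mathcal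 S^i}\left(\Big(\frac{\pi^2}{6}D+1\Big)\Delta_a^i+\frac{36\,\Delta_a^i}{\big(\max_{1\le j\le D}(\Delta_a^j-\delta_j)\big)^2}\log\frac{17}{\max_{1\le j\le D}(\Delta_a^j-\delta_j)}\right).$$ -/

import Mathlib

open MeasureTheory ProbabilityTheory

namespace LexBandit

noncomputable section

/-! ### Lexicographic optimality.

There are `A` arms and `D` objectives, indexed by `Fin A` and `Fin D` (so objective `1` is `0`);
`μ a i` is the expected reward of arm `a` in objective `i`. -/

/-- `u` lexicographically dominates `v` in the first `m` objectives: `v j < u j` for the first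
objective `j` among the first `m` ones at which `u` and `v` differ. -/
def LexDominates {D : ℕ} (m : ℕ) (u v : Fin D → ℝ) : Prop :=
  ∃ j : Fin D, (j : ℕ) < m ∧ v j < u j ∧ ∀ k : Fin D, k < j → u k = v k

/-- The arms that are lexicographic optimal in the first `m` objectives. -/
def lexOptArms {A D : ℕ} (μ : Fin A → Fin D → ℝ) (m : ℕ) : Set (Fin A) :=
  {a | ∀ a' : Fin A, ¬ LexDominates m (μ a') (μ a)}

/-- The gap of arm `a` in objective `i`, relative to the arm `star`
(to be a lexicographic optimal arm; the gap does not depend on which one). -/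
def gap {A D : ℕ} (μ : Fin A → Fin D → ℝ) (star a : Fin A) (i : Fin D) : ℝ :=
  μ star i - μ a i

open Classical in
/-- The set of suboptimal arms in objective `i`: those with a positive gap. -/
def suboptArms {A D : ℕ} (μ : Fin A → Fin D → ℝ) (star : Fin A) (i : Fin D) : Finset (Fin A) :=
  Finset.univ.filter fun a => 0 < gap μ star a i

/-- The least gap in objective `i` among the suboptimal arms in objective `i`;
it is `⊤` if there is no such arm. -/
def minGap {A D : ℕ} (μ : Fin A → Fin D → ℝ) (star : Fin A) (i : Fin D) : EReal :=
  ⨅ a ∈ suboptArms μ star i, (gap μ star a i : EReal)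

/-! ### The algorithm NOM-LEX.

Rounds are indexed by `ℕ`, the first round being `0`. A record `x` lists for every round the
selected arm and the observed vector; the functions of `x` and `n` below only look at the rounds
before round `n`. -/

open Classical in
/-- The number of times arm `b` was selected before round `n`. -/
def pulls {A D : ℕ} (x : ℕ → Fin A × (Fin D → ℝ)) (n : ℕ) (b : Fin A) : ℕ :=
  ((Finset.range n).filter fun s => (x s).1 = b).card

open Classical in
/-- The sample mean in objective `i` of the observations of arm `b` made before round `n`. -/
def sampleMean {A D : ℕ} (x : ℕ → Fin A × (Fin D → ℝ)) (n : ℕ) (b : Fin A) (i : Fin D) : ℝ :=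
  (∑ s ∈ (Finset.range n).filter (fun s => (x s).1 = b), (x s).2 i) / (pulls x n b : ℝ)

open Classical in
/-- The set of estimated lexicographic optimal arms at the beginning of round `n`. -/
def estArms {A D : ℕ} (x : ℕ → Fin A × (Fin D → ℝ)) (n : ℕ) : Finset (Fin A) :=
  Finset.univ.filter fun b => ∀ i : Fin D,
    -Real.sqrt (4 * Real.log (pulls x n b : ℝ) / (pulls x n b : ℝ)) < sampleMean x n b i

open Classical in
/-- The position, at the beginning of round `n`, in the current sweep through the arms
`0, 1, …, A - 1`. If it is less than `A`, a sweep is under way and the arm with this index is next;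
if it is `A`, no sweep is under way. The algorithm starts with a sweep; when no sweep is under way,
a new one starts (with arm `0`, in the very round) if and only if the set of estimated
lexicographic optimal arms is empty. -/
def sweepPos {A D : ℕ} (x : ℕ → Fin A × (Fin D → ℝ)) : ℕ → ℕ
  | 0 => 0
  | n + 1 =>
    if sweepPos x n < A then sweepPos x n + 1
    else if (estArms x n).Nonempty then A
    else 1

open Classical in
/-- The probability with which NOM-LEX selects arm `b` in round `n`, given the rounds before:
during a sweep the next arm is selected; otherwise an arm of `estArms x n` is selected uniformly at
random, or a new sweep starts with arm `0` if that set is empty. -/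
def selectProb {A D : ℕ} (x : ℕ → Fin A × (Fin D → ℝ)) (n : ℕ) (b : Fin A) : ℝ :=
  if sweepPos x n < A then (if (b : ℕ) = sweepPos x n then 1 else 0)
  else if (estArms x n).Nonempty then (if b ∈ estArms x n then 1 / ((estArms x n).card : ℝ) else 0)
  else (if (b : ℕ) = 0 then 1 else 0)

/-! ### The interaction of NOM-LEX with the bandit. -/

/-- The reward vector of round `n`: expected reward of the selected arm plus noise. -/
def reward {A D : ℕ} {Ω : Type*} (μ : Fin A → Fin D → ℝ) (act : ℕ → Ω → Fin A)
    (noise : ℕ → Ω → Fin D → ℝ) (n : ℕ) (ω : Ω) : Fin D → ℝ :=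
  fun i => μ (act n ω) i + noise n ω i

/-- The record on which NOM-LEX works: selected arms, and rewards from which the known
near-lexicographic optimal expected rewards `η` have been subtracted (so that in the shifted problem
the prior knowledge is `0` in every objective). -/
def shiftedRecord {A D : ℕ} {Ω : Type*} (μ : Fin A → Fin D → ℝ) (η : Fin D → ℝ)
    (act : ℕ → Ω → Fin A) (noise : ℕ → Ω → Fin D → ℝ) (ω : Ω) : ℕ → Fin A × (Fin D → ℝ) :=
  fun n => (act n ω, fun i => reward μ act noise n ω i - η i)

/-- The σ-algebra of what is observed (selected arms and rewards) before round `n`. -/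
abbrev pastSigma {A D : ℕ} {Ω : Type*} (μ : Fin A → Fin D → ℝ) (act : ℕ → Ω → Fin A)
    (noise : ℕ → Ω → Fin D → ℝ) (n : ℕ) : MeasurableSpace Ω :=
  MeasurableSpace.comap
    (fun ω => fun s : Fin n => (act s ω, reward μ act noise s ω)) inferInstance

/-- `act` and `noise` are the selected arms and the noise vectors of a run of NOM-LEX, with prior
knowledge `η`, on the bandit with expected rewards `μ` and noise distributions `ν`. -/
structure IsNOMLEXRun {A D : ℕ} {Ω : Type*} [MeasurableSpace Ω] (P : Measure Ω)
    (μ : Fin A → Fin D → ℝ) (ν : Fin A → Measure (Fin D → ℝ)) (η : Fin D → ℝ)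
    (act : ℕ → Ω → Fin A) (noise : ℕ → Ω → Fin D → ℝ) : Prop where
  measurable_act : ∀ n, Measurable (act n)
  measurable_noise : ∀ n, Measurable (noise n)
  /-- Given the past, the arm of round `n` is drawn according to NOM-LEX. -/
  cond_act : ∀ (n : ℕ) (b : Fin A),
    P[(act n ⁻¹' {b}).indicator (fun _ => (1 : ℝ)) | pastSigma μ act noise n]
      =ᵐ[P] fun ω => selectProb (shiftedRecord μ η act noise ω) n b
  /-- Given the past and the arm `a` selected in round `n`, the noise vector of round `n` has
  distribution `ν a`. -/
  cond_noise : ∀ (n : ℕ) (B : Set (Fin D → ℝ)), MeasurableSet B →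
    P[(noise n ⁻¹' B).indicator (fun _ => (1 : ℝ)) |
        pastSigma μ act noise n ⊔ MeasurableSpace.comap (act n) inferInstance]
      =ᵐ[P] fun ω => (ν (act n ω)).real B

/-- The priority-free regret in objective `i` of the first `T` rounds. -/
def priorityFreeRegret {A D : ℕ} {Ω : Type*} (μ : Fin A → Fin D → ℝ) (star : Fin A)
    (act : ℕ → Ω → Fin A) (i : Fin D) (T : ℕ) (ω : Ω) : ℝ :=
  ∑ n ∈ Finset.range T, gap μ star (act n ω) i

/-- The difference `δ i` of the lexicographic optimal and the near-lexicographic optimal expected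
rewards in objective `i`. -/
def slack {A D : ℕ} (μ : Fin A → Fin D → ℝ) (star : Fin A) (η : Fin D → ℝ) (i : Fin D) : ℝ :=
  μ star i - η i

/-- The maximum over the objectives `j` of `gap j - δ j` for arm `a`. -/
def maxExcess {A D : ℕ} (μ : Fin A → Fin D → ℝ) (star : Fin A) (η : Fin D → ℝ) (a : Fin A) : ℝ :=
  ⨆ j : Fin D, (gap μ star a j - slack μ star η j)

end

end LexBandit

/-! Fix a suboptimal arm `b` with excess `m`, attained in objective `j`, so that its shifted mean
there is `-m`. Its selections are counted by a charging argument. The initial sweep contributes at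
most one. A later sweep starts only if every arm is rejected, in particular `star`, whose shifted
means are nonnegative. With `k` the number of selections of `star` so far, the noise of its first
`k` selections then sums to at most `-√(4k log k)` in some objective. Distinct sweeps have distinct
`k`, and each such event has probability at most `1/k²`, so at most `D π²/6` later sweeps are
expected. A selection outside of sweeps requires that `b` be accepted, so with `k` selections of `b`
its noise sum in objective `j` is at least `km - √(4k log k)`. This has probability at most `exp(-k
m²/8)` once `16 log k ≤ k m²`, and the sum over `k` is about `36/m² · log(17/m)`.

For large `m` the logarithm is small or negative and the last sum may exceed this value, by at most
0.026. The loss is recovered from the sweeps: at `k = 2, 3` the bound `1/k²` is not sharp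
(`tailGain`).

The counting is `pulls_le_sum_indicator`, the concentration `hasSubgaussianMGF_truncNoise`, and the
numerical work `sum_tail_le` and `measureReal_le_neg_sqrt_le`; `integral_pulls_le` combines them. -/

namespace LexBandit

/-! ### Pathwise counting of selections inside and outside of sweeps. -/

section Deterministic

variable {A D : ℕ} {x : ℕ → Fin A × (Fin D → ℝ)}

lemma pulls_succ (x : ℕ → Fin A × (Fin D → ℝ)) (n : ℕ) (b : Fin A) :
    pulls x (n + 1) b = pulls x n b + if (x n).1 = b then 1 else 0 := by
  classical
  simp only [pulls, Finset.card_filter, Finset.sum_range_succ]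

lemma pulls_mono (x : ℕ → Fin A × (Fin D → ℝ)) (b : Fin A) : Monotone fun n => pulls x n b :=
  monotone_nat_of_le_succ fun n => by simp only [pulls_succ]; omega

lemma pulls_lt_of_lt {s t : ℕ} {b : Fin A} (hs : (x s).1 = b) (hst : s < t) :
    pulls x s b < pulls x t b := by
  have h1 := pulls_mono x b (Nat.succ_le_of_lt hst)
  have h2 := pulls_succ x s b
  simp only [hs, if_true] at h2
  simp only [Nat.succ_eq_add_one] at h1
  omega

lemma pulls_le (x : ℕ → Fin A × (Fin D → ℝ)) (n : ℕ) (b : Fin A) : pulls x n b ≤ n := by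
  classical
  simpa [pulls] using
    Finset.card_filter_le (Finset.range n) fun s => (x s).1 = b

/-- Round `t` starts a sweep other than the initial one. -/
def IsSweepStart (x : ℕ → Fin A × (Fin D → ℝ)) (t : ℕ) : Prop :=
  A ≤ sweepPos x t ∧ ¬ (estArms x t).Nonempty

/-- Round `t` belongs to a sweep. -/
def InSweep (x : ℕ → Fin A × (Fin D → ℝ)) (t : ℕ) : Prop :=
  sweepPos x t < A ∨ ¬ (estArms x t).Nonempty

open Classical in
/-- The rounds before round `T` that start a sweep other than the initial one. -/
noncomputable def sweepStarts (x : ℕ → Fin A × (Fin D → ℝ)) (T : ℕ) : Finset ℕ :=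
  (Finset.range T).filter (IsSweepStart x)

open Classical in
/-- The number of selections of arm `b` before round `T` that belong to a sweep. -/
noncomputable def sweepPulls (x : ℕ → Fin A × (Fin D → ℝ)) (T : ℕ) (b : Fin A) : ℕ :=
  ((Finset.range T).filter fun t => (x t).1 = b ∧ InSweep x t).card

open Classical in
/-- The rounds before round `T` in which arm `b` is selected outside of sweeps. -/
noncomputable def estPulls (x : ℕ → Fin A × (Fin D → ℝ)) (T : ℕ) (b : Fin A) : Finset ℕ :=
  (Finset.range T).filter fun t => (x t).1 = b ∧ ¬ InSweep x t

lemma sweepPos_le (hA : 0 < A) (x : ℕ → Fin A × (Fin D → ℝ)) (n : ℕ) : sweepPos x n ≤ A := by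
  induction n with
  | zero => simp [sweepPos]
  | succ n ih =>
    rw [sweepPos]
    split_ifs <;> omega

lemma pulls_eq_sweepPulls_add (x : ℕ → Fin A × (Fin D → ℝ)) (T : ℕ) (b : Fin A) :
    pulls x T b = sweepPulls x T b + (estPulls x T b).card := by
  classical
  rw [pulls, sweepPulls, estPulls, ← Finset.filter_filter, ← Finset.filter_filter,
    Finset.card_filter_add_card_filter_not]

/-- Each completed sweep selects `b` exactly once, and a sweep under way has already selected `b`
iff its position has passed `b`. The initial sweep is not in `sweepStarts`; it accounts for the
extra 1 when no sweep is under way. -/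
lemma sweepPulls_eq (hx : ∀ n, selectProb x n (x n).1 ≠ 0) (T : ℕ) (b : Fin A) :
    sweepPulls x T b = (sweepStarts x T).card + if (b : ℕ) < sweepPos x T then 1 else 0 := by
  classical
  have hA : 0 < A := b.pos
  induction T with
  | zero => simp [sweepPulls, sweepStarts, sweepPos]
  | succ T ih =>
    have h1 : sweepPulls x (T + 1) b
        = sweepPulls x T b + if (x T).1 = b ∧ InSweep x T then 1 else 0 := by
      simp only [sweepPulls, Finset.card_filter, Finset.sum_range_succ]
    have h2 : (sweepStarts x (T + 1)).card
        = (sweepStarts x T).card + if IsSweepStart x T then 1 else 0 := by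
      simp only [sweepStarts, Finset.card_filter, Finset.sum_range_succ]
    have hle := sweepPos_le hA x T
    have hb := b.isLt
    have hT := hx T
    rw [h1, h2, ih]
    simp only [selectProb] at hT
    rw [sweepPos]
    simp only [IsSweepStart, InSweep, Fin.ext_iff]
    by_cases hlt : sweepPos x T < A
    · simp only [hlt, if_true] at hT ⊢
      have hc : ((x T).1 : ℕ) = sweepPos x T := by
        by_contra h; simp [h] at hT
      simp only [hc, not_le.mpr hlt, true_or, and_true, false_and, if_false]
      split_ifs <;> omega
    · simp only [hlt, if_false] at hT ⊢
      by_cases hne : (estArms x T).Nonempty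
      · simp only [hne, not_true, and_false, if_false, if_true, or_false]
        split_ifs <;> omega
      · simp only [hne, if_false] at hT ⊢
        have hc : ((x T).1 : ℕ) = 0 := by
          by_contra h; simp [h] at hT
        simp only [hc, not_lt.mp hlt, not_false_eq_true, or_true, and_true, if_true]
        split_ifs <;> omega

lemma estPulls_mono (x : ℕ → Fin A × (Fin D → ℝ)) (b : Fin A) {s t : ℕ} (h : s ≤ t) :
    (estPulls x s b).card ≤ (estPulls x t b).card := by
  classical
  refine Finset.card_le_card (Finset.filter_subset_filter _ ?_)
  simpa using h

lemma one_le_pulls_of_sweepPos (hx : ∀ n, selectProb x n (x n).1 ≠ 0) {t : ℕ}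
    (ht : A ≤ sweepPos x t) (b : Fin A) : 1 ≤ pulls x t b := by
  have h := sweepPulls_eq hx t b
  rw [if_pos (b.isLt.trans_le ht)] at h
  have := pulls_eq_sweepPulls_add x t b
  omega

/-- Between two sweep starts a whole sweep is completed, and it selects every arm. Hence a sweep can
be charged to the selection count of any fixed arm. -/
lemma pulls_injOn_sweepStarts (hx : ∀ n, selectProb x n (x n).1 ≠ 0) (T : ℕ) (b : Fin A) :
    Set.InjOn (fun t => pulls x t b) (sweepStarts x T : Set ℕ) := by
  classical
  have key : ∀ s t, IsSweepStart x s → IsSweepStart x t → s < t →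
      pulls x s b < pulls x t b := by
    intro s t hs ht hst
    have h1 := sweepPulls_eq hx s b
    have h2 := sweepPulls_eq hx t b
    rw [if_pos (b.isLt.trans_le hs.1)] at h1
    rw [if_pos (b.isLt.trans_le ht.1)] at h2
    have h3 := pulls_eq_sweepPulls_add x s b
    have h4 := pulls_eq_sweepPulls_add x t b
    have h5 := estPulls_mono x b hst.le
    have h6 : (sweepStarts x s).card < (sweepStarts x t).card := by
      refine Finset.card_lt_card ((Finset.ssubset_iff_of_subset ?_).2 ⟨s, ?_, ?_⟩)
      · exact Finset.filter_subset_filter _ (by simpa using hst.le)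
      · simp [sweepStarts, hst, hs]
      · simp [sweepStarts]
    omega
  intro s hs t ht hst
  simp only [sweepStarts, Finset.coe_filter, Set.mem_ofPred_eq] at hs ht hst
  rcases lt_trichotomy s t with h | h | h
  · have := key s t hs.2 ht.2 h; omega
  · exact h
  · have := key t s ht.2 hs.2 h; omega

lemma pulls_injOn_estPulls (x : ℕ → Fin A × (Fin D → ℝ)) (T : ℕ) (b : Fin A) :
    Set.InjOn (fun t => pulls x t b) (estPulls x T b : Set ℕ) := by
  classical
  intro s hs t ht hst
  simp only [estPulls, Finset.coe_filter, Set.mem_ofPred_eq] at hs ht hst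
  rcases lt_trichotomy s t with h | h | h
  · have := pulls_lt_of_lt hs.2.1 h; omega
  · exact h
  · have := pulls_lt_of_lt ht.2.1 h; omega

/-- Every sweep start is charged to the number of selections of `c` at this time, and every
selection of `b` outside of sweeps to the number of selections of `b` at this time. -/
lemma pulls_le_sum_indicator (hx : ∀ n, selectProb x n (x n).1 ≠ 0) (T : ℕ) (b c : Fin A)
    (p q : ℕ → Prop) [DecidablePred p] [DecidablePred q]
    (hp : ∀ t < T, 1 ≤ pulls x t c → c ∉ estArms x t → p (pulls x t c))
    (hq : ∀ t < T, 1 ≤ pulls x t b → b ∈ estArms x t → q (pulls x t b)) :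
    pulls x T b ≤ 1 + (∑ k ∈ Finset.Icc 1 T, if p k then 1 else 0)
      + ∑ k ∈ Finset.Icc 1 T, if q k then 1 else 0 := by
  classical
  have h1 : (sweepStarts x T).card ≤ ∑ k ∈ Finset.Icc 1 T, if p k then 1 else 0 := by
    rw [← Finset.card_filter]
    refine Finset.card_le_card_of_injOn (fun t => pulls x t c) ?_ (pulls_injOn_sweepStarts hx T c)
    intro t ht
    simp only [sweepStarts, Finset.coe_filter, Set.mem_ofPred_eq, Finset.mem_range] at ht
    have h1 := one_le_pulls_of_sweepPos hx ht.2.1 c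
    have h2 := pulls_le x t c
    simp only [Finset.coe_filter, Set.mem_ofPred_eq, Finset.mem_Icc]
    exact ⟨⟨h1, h2.trans ht.1.le⟩, hp t ht.1 h1 fun h => ht.2.2 ⟨c, h⟩⟩
  have h2 : (estPulls x T b).card ≤ ∑ k ∈ Finset.Icc 1 T, if q k then 1 else 0 := by
    rw [← Finset.card_filter]
    refine Finset.card_le_card_of_injOn (fun t => pulls x t b) ?_ (pulls_injOn_estPulls x T b)
    intro t ht
    simp only [estPulls, InSweep, Finset.coe_filter, Set.mem_ofPred_eq, Finset.mem_range,
      not_or, not_not, not_lt] at ht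
    obtain ⟨htT, htb, hpos, hne⟩ := ht
    have h1 := one_le_pulls_of_sweepPos hx hpos b
    have h2 := pulls_le x t b
    have h3 := hx t
    simp only [selectProb, not_lt.mpr hpos, if_false, hne, if_true, htb] at h3
    simp only [Finset.coe_filter, Set.mem_ofPred_eq, Finset.mem_Icc]
    refine ⟨⟨h1, h2.trans htT.le⟩, hq t htT h1 ?_⟩
    by_contra h
    simp [h] at h3
  have h3 := pulls_eq_sweepPulls_add x T b
  have h4 := sweepPulls_eq hx T b
  have h5 : (if (b : ℕ) < sweepPos x T then 1 else 0) ≤ 1 := by split_ifs <;> omega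
  omega

open Classical in
/-- The sum of `v` over the first `k` selections of arm `b`, as far as they are before round `T`. -/
noncomputable def truncSum (x : ℕ → Fin A × (Fin D → ℝ)) (b : Fin A) (k : ℕ) (v : ℕ → ℝ)
    (T : ℕ) : ℝ :=
  ∑ s ∈ Finset.range T, if (x s).1 = b ∧ pulls x s b < k then v s else 0

-- The selection count at a given round is random. Expressing the observed sum through `truncSum` at
-- that count allows a union bound over deterministic `k`.
open Classical in
lemma truncSum_eq {t T : ℕ} (htT : t ≤ T) (b : Fin A) (v : ℕ → ℝ) :
    truncSum x b (pulls x t b) v T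
      = ∑ s ∈ (Finset.range t).filter (fun s => (x s).1 = b), v s := by
  rw [truncSum, ← Finset.sum_filter]
  congr 1
  ext s
  simp only [Finset.mem_filter, Finset.mem_range]
  constructor
  · rintro ⟨_, h2, h3⟩
    refine ⟨?_, h2⟩
    by_contra h
    exact absurd (pulls_mono x b (not_lt.mp h)) (not_le.mpr h3)
  · rintro ⟨h1, h2⟩
    exact ⟨h1.trans_le htT, h2, pulls_lt_of_lt h2 h1⟩

lemma sampleMean_eq {t T : ℕ} (htT : t ≤ T) (b : Fin A) (i : Fin D) (c : ℝ) (v : ℕ → ℝ)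
    (hv : ∀ s, (x s).1 = b → (x s).2 i = c + v s) (hpos : 1 ≤ pulls x t b) :
    sampleMean x t b i
      = c + truncSum x b (pulls x t b) v T / (pulls x t b : ℝ) := by
  classical
  have hk : (0 : ℝ) < pulls x t b := by exact_mod_cast hpos
  rw [truncSum_eq htT, sampleMean,
    Finset.sum_congr rfl fun s hs => hv s (Finset.mem_filter.1 hs).2, Finset.sum_add_distrib,
    Finset.sum_const, nsmul_eq_mul, add_div]
  congr 1
  rw [show ((Finset.range t).filter fun s => (x s).1 = b).card = pulls x t b by
    simp only [pulls]]
  field_simp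

end Deterministic

end LexBandit
namespace LexBandit

/-! ### Numerical estimates for the sums of tail bounds. -/

section Analysis

lemma sum_exp_neg_mul_le {β : ℝ} (hβ : 0 < β) (s : Finset ℕ) {N : ℕ} (hs : ∀ k ∈ s, N ≤ k) :
    ∑ k ∈ s, Real.exp (-(k * β)) ≤ Real.exp (-(N * β)) / (1 - Real.exp (-β)) := by
  have hr0 : 0 ≤ Real.exp (-β) := (Real.exp_pos _).le
  have hr1 : Real.exp (-β) < 1 := Real.exp_lt_one_iff.2 (by linarith)
  have hgeo := (hasSum_geometric_of_lt_one hr0 hr1).mul_left (Real.exp (-(N * β)))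
  have hinj : Set.InjOn (fun k => k - N) (s : Set ℕ) := by
    intro a ha b hb hab
    have := hs a ha; have := hs b hb
    simp only at hab
    omega
  have h1 : ∑ k ∈ s, Real.exp (-(k * β))
      = ∑ j ∈ s.image (fun k => k - N), Real.exp (-(N * β)) * Real.exp (-β) ^ j := by
    rw [Finset.sum_image hinj]
    refine Finset.sum_congr rfl fun k hk => ?_
    rw [← Real.exp_nat_mul, ← Real.exp_add, Nat.cast_sub (hs k hk)]
    congr 1; ring
  rw [h1, div_eq_mul_inv]
  exact sum_le_hasSum _ (fun j _ => by positivity) hgeo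

lemma one_div_one_sub_exp_neg_le {β : ℝ} (hβ : 0 < β) : 1 / (1 - Real.exp (-β)) ≤ 1 + 1 / β := by
  have h1 : Real.exp (-β) < 1 := Real.exp_lt_one_iff.2 (by linarith)
  have h2 := Real.add_one_le_exp β
  have h3 : Real.exp (-β) * Real.exp β = 1 := by rw [← Real.exp_add]; simp
  have h4 : 0 < Real.exp (-β) := Real.exp_pos _
  rw [div_le_iff₀ (by linarith)]
  have h5 : Real.exp (-β) * (β + 1) ≤ 1 := by nlinarith
  have h6 : (1 + 1 / β) * (1 - Real.exp (-β)) - 1 = (1 - Real.exp (-β) * (β + 1)) / β := by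
    field_simp; ring
  have h7 : 0 ≤ (1 - Real.exp (-β) * (β + 1)) / β := div_nonneg (by linarith) hβ.le
  linarith

lemma log_le_div_add {y s : ℝ} (hy : 0 < y) (hs : 0 < s) :
    Real.log y ≤ y / s + Real.log s - 1 := by
  have h := Real.log_le_sub_one_of_pos (div_pos hy hs)
  rw [Real.log_div hy.ne' hs.ne'] at h
  linarith

/-- The tail terms are controlled once `m ^ 2 * k` exceeds the logarithmic threshold. -/
lemma log_le_of_threshold {m : ℝ} (hm : 0 < m) {k : ℕ} (hk : 1 ≤ k)
    (h : 36 * Real.log (17 / m) - 8 ≤ k * m ^ 2) : 16 * Real.log k ≤ k * m ^ 2 := by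
  have hk0 : (0 : ℝ) < k := by exact_mod_cast hk
  -- The tangent of `log` at 144 leaves `8/9` of `k m²`, so the coefficient of `log (1/m)` becomes
  -- `32 · 9/8 = 36`, as in the threshold.
  have h1 := log_le_div_add (y := k * m ^ 2) (s := 144) (by positivity) (by norm_num)
  rw [Real.log_mul hk0.ne' (by positivity), Real.log_pow] at h1
  rw [Real.log_div (by norm_num) hm.ne'] at h
  have e1 : Real.log 144 = 4 * Real.log 2 + 2 * Real.log 3 := by
    rw [show (144 : ℝ) = 2 ^ 4 * 3 ^ 2 by norm_num, Real.log_mul (by norm_num) (by norm_num),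
      Real.log_pow, Real.log_pow]; norm_num
  have e2 : 4 * Real.log 2 ≤ Real.log 17 := by
    rw [show 4 * Real.log 2 = Real.log (2 ^ 4) by rw [Real.log_pow]; norm_num]
    exact Real.log_le_log (by norm_num) (by norm_num)
  have e3 : 2 * Real.log 3 ≤ 4 * Real.log 2 := by
    rw [show 4 * Real.log 2 = Real.log (2 ^ 4) by rw [Real.log_pow]; norm_num,
      show 2 * Real.log 3 = Real.log (3 ^ 2) by rw [Real.log_pow]; norm_num]
    exact Real.log_le_log (by norm_num) (by norm_num)
  have e4 := Real.log_two_lt_d9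
  push_cast at h1
  linarith

lemma log_le_of_three_le {m : ℝ} (hm : 3 ≤ m) {k : ℕ} (hk : 1 ≤ k) :
    16 * Real.log k ≤ k * m ^ 2 := by
  have hk0 : (0 : ℝ) < k := by exact_mod_cast hk
  have h1 := Real.log_le_sub_one_of_pos (show (0 : ℝ) < k / 2 by positivity)
  rw [Real.log_div hk0.ne' (by norm_num)] at h1
  have e4 := Real.log_two_lt_d9
  nlinarith [mul_nonneg hk0.le (show 0 ≤ m ^ 2 - 9 by nlinarith)]

/-- Terms up to `y = (36 L - 8)/m²` are bounded by 1. Beyond `y` the series is geometric with sum at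
most `8/m²`, which the 8 set aside in `y` pays for. The condition `m < 3` gives `L ≥ 1` and makes
`0.37 (m² + 8) ≤ 8`. -/
lemma sum_le_of_lt_three {m : ℝ} (hm : 0 < m) (hm3 : m < 3) (T : ℕ) (p : ℕ → ℝ)
    (hp1 : ∀ k, p k ≤ 1)
    (hp2 : ∀ k : ℕ, 1 ≤ k → 16 * Real.log k ≤ k * m ^ 2 → p k ≤ Real.exp (-(k * (m ^ 2 / 8)))) :
    ∑ k ∈ Finset.Icc 1 T, p k ≤ 36 / m ^ 2 * Real.log (17 / m) := by
  have hm2 : 0 < m ^ 2 := by positivity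
  set L := Real.log (17 / m) with hL
  have hL1 : 1 ≤ L := by
    rw [hL, Real.le_log_iff_exp_le (by positivity), le_div_iff₀ hm]
    have := Real.exp_one_lt_d9
    nlinarith [Real.exp_pos 1]
  set y := (36 * L - 8) / m ^ 2 with hy
  have hy0 : 0 ≤ y := div_nonneg (by linarith) hm2.le
  set N := ⌊y⌋₊ with hN
  have hNy : (N : ℝ) ≤ y := Nat.floor_le hy0
  have hNy' : y < N + 1 := Nat.lt_floor_add_one y
  have hym : y * m ^ 2 = 36 * L - 8 := by rw [hy]; field_simp
  rw [← Finset.sum_filter_add_sum_filter_not (Finset.Icc 1 T) (fun k => k ≤ N)]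
  have h1 : ∑ k ∈ (Finset.Icc 1 T).filter (fun k => k ≤ N), p k ≤ y := by
    calc _ ≤ ∑ k ∈ (Finset.Icc 1 T).filter (fun k => k ≤ N), (1 : ℝ) :=
          Finset.sum_le_sum fun k _ => hp1 k
      _ = ((Finset.Icc 1 T).filter (fun k => k ≤ N)).card := by simp
      _ ≤ (Finset.Icc 1 N).card := by
          norm_cast
          refine Finset.card_le_card fun k hk => ?_
          simp only [Finset.mem_filter, Finset.mem_Icc] at hk ⊢
          exact ⟨hk.1.1, hk.2⟩
      _ ≤ y := by simpa using hNy
  have h2 : ∑ k ∈ (Finset.Icc 1 T).filter (fun k => ¬ k ≤ N), p k ≤ 8 / m ^ 2 := by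
    have hβ : 0 < m ^ 2 / 8 := by positivity
    have hthr : ∀ k ∈ (Finset.Icc 1 T).filter (fun k => ¬ k ≤ N), N + 1 ≤ k := by
      intro k hk
      simp only [Finset.mem_filter, Finset.mem_Icc] at hk
      omega
    calc _ ≤ ∑ k ∈ (Finset.Icc 1 T).filter (fun k => ¬ k ≤ N), Real.exp (-(k * (m ^ 2 / 8))) := by
          refine Finset.sum_le_sum fun k hk => ?_
          have h := hthr k hk
          have h' : (N : ℝ) + 1 ≤ k := by exact_mod_cast h
          refine hp2 k (by omega) (log_le_of_threshold hm (by omega) ?_)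
          rw [← hL, ← hym]
          exact mul_le_mul_of_nonneg_right (by linarith) hm2.le
      _ ≤ _ := sum_exp_neg_mul_le hβ _ hthr
      _ = Real.exp (-((N + 1 : ℕ) * (m ^ 2 / 8))) * (1 / (1 - Real.exp (-(m ^ 2 / 8)))) := by
          rw [mul_one_div]
      _ ≤ Real.exp (-1) * (1 + 1 / (m ^ 2 / 8)) := by
          refine mul_le_mul (Real.exp_le_exp.2 ?_) (one_div_one_sub_exp_neg_le hβ) ?_
            (Real.exp_pos _).le
          · push_cast
            nlinarith
          · have : Real.exp (-(m ^ 2 / 8)) < 1 := Real.exp_lt_one_iff.2 (by linarith)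
            exact one_div_nonneg.2 (by linarith)
      _ ≤ 0.37 * (1 + 8 / m ^ 2) := by
          rw [one_div_div]
          refine mul_le_mul_of_nonneg_right ?_ (by positivity)
          have := Real.exp_neg_one_lt_d9
          linarith
      _ ≤ 8 / m ^ 2 := by
          rw [show 0.37 * (1 + 8 / m ^ 2) = (0.37 * (m ^ 2 + 8)) / m ^ 2 by field_simp]
          refine div_le_div_of_nonneg_right ?_ hm2.le
          nlinarith
  calc _ ≤ y + 8 / m ^ 2 := add_le_add h1 h2
    _ = 36 / m ^ 2 * L := by rw [hy]; field_simp; ring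

/-- The sum of the tail bounds of an arm with excess `m`. -/
lemma sum_tail_le {m : ℝ} (hm : 0 < m) (T : ℕ) (p : ℕ → ℝ)
    (hp1 : ∀ k, p k ≤ 1)
    (hp2 : ∀ k : ℕ, 1 ≤ k → 16 * Real.log k ≤ k * m ^ 2 → p k ≤ Real.exp (-(k * (m ^ 2 / 8)))) :
    ∑ k ∈ Finset.Icc 1 T, p k ≤ 36 / m ^ 2 * Real.log (17 / m) + 0.026 := by
  rcases lt_or_ge m 3 with hm3 | hm3
  · linarith [sum_le_of_lt_three hm hm3 T p hp1 hp2]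
  have hm2 : 0 < m ^ 2 := by positivity
  have hβ : 0 < m ^ 2 / 8 := by positivity
  set r := Real.exp (-(m ^ 2 / 8)) with hr
  have hr1 : r < 1 := Real.exp_lt_one_iff.2 (by linarith)
  have h1 : ∑ k ∈ Finset.Icc 1 T, p k ≤ r / (1 - r) := by
    calc _ ≤ ∑ k ∈ Finset.Icc 1 T, Real.exp (-(k * (m ^ 2 / 8))) := by
          refine Finset.sum_le_sum fun k hk => ?_
          have hk1 := (Finset.mem_Icc.1 hk).1
          exact hp2 k hk1 (log_le_of_three_le hm3 hk1)
      _ ≤ _ := by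
          have := sum_exp_neg_mul_le hβ (Finset.Icc 1 T) (N := 1) fun k hk => (Finset.mem_Icc.1 hk).1
          simpa using this
  have h2 : r / (1 - r) ≤ 8 / m ^ 2 := by
    have := one_div_one_sub_exp_neg_le hβ
    rw [one_div_div] at this
    have e : r / (1 - r) = 1 / (1 - r) - 1 := by
      have : 1 - r ≠ 0 := by linarith
      field_simp; ring
    rw [e]; linarith
  -- Up to 13 the logarithm is at least `1 - 13/17 ≥ 2/9`, and `36 · 2/9 = 8` covers the whole
  -- geometric series.
  rcases le_or_gt m 13 with hm13 | hm13
  · have hL : 2 / 9 ≤ Real.log (17 / m) := by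
      have h3 := Real.one_sub_inv_le_log_of_pos (show 0 < 17 / m by positivity)
      rw [inv_div] at h3
      have : m / 17 ≤ 13 / 17 := by gcongr
      linarith
    calc _ ≤ 8 / m ^ 2 := h1.trans h2
      _ = 36 / m ^ 2 * (2 / 9) := by ring
      _ ≤ 36 / m ^ 2 * Real.log (17 / m) := by gcongr
      _ ≤ _ := by linarith
  · have h3 : r / (1 - r) ≤ 0.003 := by
      have hr' : r ≤ 0.002 := by
        have : r ≤ Real.exp (-7) := Real.exp_le_exp.2 (by nlinarith)
        have h7 : Real.exp (-7) = Real.exp (-1) ^ 7 := by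
          rw [← Real.exp_nat_mul]; norm_num
        have h8 : Real.exp (-1) ^ 7 ≤ 0.37 ^ 7 := by
          have := Real.exp_neg_one_lt_d9
          exact pow_le_pow_left₀ (Real.exp_pos _).le (by linarith) 7
        rw [h7] at this
        norm_num at h8 ⊢
        linarith
      rw [div_le_iff₀ (by linarith)]
      linarith
    -- The term is negative for `m > 17`. With `u = (m/17)²`, the tangent bound `log u ≤ u/e` shows
    -- that it is at least `-18/(289 e) > -0.023`; together with the 0.003 above this is the origin
    -- of 0.026.
    have h4 : -0.023 ≤ 36 / m ^ 2 * Real.log (17 / m) := by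
      have hu : 0 < (m / 17) ^ 2 := by positivity
      have h5 := log_le_div_add hu (Real.exp_pos 1)
      rw [Real.log_exp, Real.log_pow, Real.log_div hm.ne' (by norm_num)] at h5
      rw [Real.log_div (by norm_num) hm.ne']
      have h6 : (m / 17) ^ 2 / Real.exp 1 ≤ 0.3679 * (m / 17) ^ 2 := by
        rw [div_eq_mul_inv, ← Real.exp_neg, mul_comm]
        have := Real.exp_neg_one_lt_d9
        exact mul_le_mul_of_nonneg_right (by linarith) hu.le
      push_cast at h5
      rw [div_mul_eq_mul_div, le_div_iff₀ hm2]
      have h7 : (m / 17) ^ 2 = m ^ 2 / 289 := by ring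
      rw [h7] at h5 h6
      nlinarith
    linarith

/-- The part of `1 / k ^ 2` that is saved in the tail bounds of the optimal arm. -/
noncomputable def tailGain (k : ℕ) : ℝ := if k = 2 then 0.02 else if k = 3 then 0.006 else 0

/-- The gains `0.02 + 0.006` equal the excess 0.026 in `sum_tail_le`. -/
lemma sum_inv_sq_sub_tailGain_le (T : ℕ) :
    ∑ k ∈ Finset.Icc 1 T, (1 / (k : ℝ) ^ 2 - tailGain k) ≤ Real.pi ^ 2 / 6 - 0.026 := by
  have h1 : HasSum tailGain (∑ k ∈ ({2, 3} : Finset ℕ), tailGain k) :=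
    hasSum_sum_of_ne_finset_zero fun k hk => by
      simp only [Finset.mem_insert, Finset.mem_singleton, not_or] at hk
      simp [tailGain, hk.1, hk.2]
  have h2 : ∑ k ∈ ({2, 3} : Finset ℕ), tailGain k = 0.026 := by
    rw [Finset.sum_pair (by norm_num)]; norm_num [tailGain]
  rw [h2] at h1
  refine sum_le_hasSum _ (fun k _ => ?_) (hasSum_zeta_two.sub h1)
  unfold tailGain
  split_ifs with h h'
  · subst h; norm_num
  · subst h'; norm_num
  · simp

end Analysis

end LexBandit
namespace LexBandit

/-! ### Tail bounds for sub-Gaussian variables. -/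

section Subgaussian

variable {Ω : Type*} [MeasurableSpace Ω] {P : Measure Ω}

/-- Since `1 + t e ≤ mgf X P t ≤ exp (c t²/2)` for all real `t`, with equality of the outer terms at
`t = 0`, their derivatives there agree, so `e = 0`. -/
lemma integral_eq_zero_of_hasSubgaussianMGF [IsProbabilityMeasure P] {X : Ω → ℝ} {c : NNReal}
    (h : HasSubgaussianMGF X c P) : ∫ ω, X ω ∂P = 0 := by
  set e := ∫ ω, X ω ∂P
  set g : ℝ → ℝ := fun t => Real.exp (c * t ^ 2 / 2) - (t * e + 1)
  have hg : ∀ t, 0 ≤ g t := by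
    intro t
    have h1 : t * e + 1 ≤ mgf X P t := by
      have hi : Integrable (fun ω => t * X ω + 1) P :=
        (h.integrable.const_mul t).add (integrable_const 1)
      have := integral_mono hi (h.integrable_exp_mul t) fun ω => Real.add_one_le_exp (t * X ω)
      rw [integral_add (h.integrable.const_mul t) (integrable_const 1), integral_const_mul] at this
      simpa [mgf, e] using this
    have h2 := h.mgf_le t
    simp only [g]; linarith
  have hmin : IsLocalMin g 0 := Filter.Eventually.of_forall fun t => by
    have : g 0 = 0 := by simp [g]
    rw [this]; exact hg t
  have hd : HasDerivAt g (-e) 0 := by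
    have h1 : HasDerivAt (fun t : ℝ => (c : ℝ) * t ^ 2 / 2) 0 0 := by
      have := (((hasDerivAt_id (0 : ℝ)).pow 2).const_mul (c : ℝ)).div_const 2
      simpa using this
    have h2 := h1.exp.sub (((hasDerivAt_id (0 : ℝ)).mul_const e).add_const 1)
    simp only [mul_zero, one_mul, zero_sub] at h2
    exact h2
  have := hmin.hasDerivAt_eq_zero hd
  linarith

/-- A sharpening of the Chernoff bound for the lower tail at a distance `t`, by the use of the
tangent of `exp` at `-log 2`. -/
lemma measureReal_le_neg_mul_le [IsProbabilityMeasure P] {X : Ω → ℝ} {n : NNReal}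
    (h : HasSubgaussianMGF X n P) {l t : ℝ} (hl : 0 ≤ l) (ht : 0 ≤ t) :
    (Real.exp (l * t) - l * t / 2 - (1 + Real.log 2) / 2) * P.real {ω | X ω ≤ -t}
      ≤ Real.exp (n * l ^ 2 / 2) - (1 + Real.log 2) / 2 := by
  set c := (1 + Real.log 2) / 2 with hc
  -- The function `f` is nonnegative by the tangent bound `2 exp y ≥ y + 1 + log 2`. Its linear term
  -- has mean zero, so subtracting `c` lowers the expectation in Markov's inequality at no cost.
  set f : Ω → ℝ := fun ω => Real.exp (-l * X ω) + l / 2 * X ω - c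
  have hlin : Integrable (fun ω => l / 2 * X ω) P := h.integrable.const_mul _
  have hexp := h.integrable_exp_mul (-l)
  have hf : Integrable f P := (hexp.add hlin).sub (integrable_const c)
  have hf0 : ∀ ω, 0 ≤ f ω := by
    intro ω
    have h1 := Real.add_one_le_exp (-l * X ω + Real.log 2)
    rw [Real.exp_add, Real.exp_log (by norm_num)] at h1
    simp only [f, hc]; linarith
  have hint : ∫ ω, f ω ∂P ≤ Real.exp (n * l ^ 2 / 2) - c := by
    have h1 : ∫ ω, f ω ∂P = mgf X P (-l) + l / 2 * ∫ ω, X ω ∂P - c := by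
      have h2 := integral_sub (hexp.add hlin) (integrable_const (μ := P) c)
      rw [integral_add' hexp hlin, integral_const_mul] at h2
      simpa [mgf, f] using h2
    rw [h1, integral_eq_zero_of_hasSubgaussianMGF h]
    have := h.mgf_le (-l)
    rw [neg_sq] at this
    linarith
  have hmarkov := mul_meas_ge_le_integral_of_nonneg (Filter.Eventually.of_forall hf0) hf
    (Real.exp (l * t) - l * t / 2 - c)
  by_cases hpos : 0 ≤ Real.exp (l * t) - l * t / 2 - c
  · refine le_trans (mul_le_mul_of_nonneg_left (measureReal_mono fun ω hω => ?_) hpos)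
      (hmarkov.trans hint)
    have hω' : X ω ≤ -t := hω
    change _ ≤ f ω
    have hxy : l * t ≤ -l * X ω := by nlinarith
    have h1 := Real.add_one_le_exp (-l * X ω - l * t)
    have h2 := Real.one_le_exp (mul_nonneg hl ht)
    have h3 : Real.exp (-l * X ω) = Real.exp (l * t) * Real.exp (-l * X ω - l * t) := by
      rw [← Real.exp_add]; congr 1; ring
    simp only [f]
    nlinarith
  · refine le_trans (mul_nonpos_of_nonpos_of_nonneg (not_le.mp hpos).le measureReal_nonneg) ?_
    exact (integral_nonneg hf0).trans hint

/-- Bound for the probability that the sample mean of `k` observations of an arm with nonnegative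
expected reward is not above the threshold of the algorithm. -/
lemma measureReal_le_neg_sqrt_le [IsProbabilityMeasure P] {X : Ω → ℝ} {k : ℕ} (hk : 1 ≤ k)
    (h : HasSubgaussianMGF X k P) :
    P.real {ω | X ω ≤ -Real.sqrt (4 * k * Real.log k)} ≤ 1 / (k : ℝ) ^ 2 - tailGain k := by
  have hk0 : (0 : ℝ) < k := by exact_mod_cast hk
  have hlog : 0 ≤ Real.log k := Real.log_nonneg (by exact_mod_cast hk)
  have hnn : 0 ≤ 4 * k * Real.log k := by positivity
  set t := Real.sqrt (4 * k * Real.log k) with ht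
  have ht2 : t ^ 2 = 4 * k * Real.log k := Real.sq_sqrt hnn
  have ht0 : 0 ≤ t := Real.sqrt_nonneg _
  have hpow : ∀ j : ℕ, Real.exp (j * Real.log k) = (k : ℝ) ^ j := fun j => by
    rw [Real.exp_nat_mul, Real.exp_log hk0]
  -- The Chernoff-optimal `l = t/k` gives `exp (l t) = k⁴` and `exp (k l²/2) = k²`.
  have hsharp := measureReal_le_neg_mul_le h (l := t / k) (by positivity) ht0
  have e1 : t / k * t = (4 : ℕ) * Real.log k := by
    rw [div_mul_eq_mul_div, ← sq, ht2]; field_simp; push_cast; ring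
  have e2 : ((k : NNReal) : ℝ) * (t / k) ^ 2 / 2 = (2 : ℕ) * Real.log k := by
    rw [div_pow, ht2]; push_cast; field_simp; ring
  rw [e2, e1, hpow, hpow] at hsharp
  have hchern : P.real {ω | X ω ≤ -t} ≤ 1 / (k : ℝ) ^ 2 := by
    have h1 := h.neg.measure_ge_le ht0
    have h2 : {ω | t ≤ (-X) ω} = {ω | X ω ≤ -t} := by
      ext ω; simp only [Set.mem_ofPred_eq, Pi.neg_apply]; constructor <;> intro h <;> linarith
    rw [h2] at h1
    refine h1.trans (le_of_eq ?_)
    rw [show -t ^ 2 / (2 * ((k : NNReal) : ℝ)) = -((2 : ℕ) * Real.log k) by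
      rw [ht2]; push_cast; field_simp; ring, Real.exp_neg, hpow, one_div]
  have l2 := Real.log_two_gt_d9
  have l2' := Real.log_two_lt_d9
  set p := P.real {ω | X ω ≤ -t}
  have hp0 : 0 ≤ p := measureReal_nonneg
  unfold tailGain
  split_ifs with h2 h3
  -- Here `hsharp` gives about 0.2291, below `1/4 - 0.02`; for `k = 3` below it gives about 0.1046,
  -- against `1/9 - 0.006 ≈ 0.1051`.
  · subst h2
    norm_num at hsharp ⊢
    by_contra hcon
    nlinarith
  · subst h3
    have l3 : Real.log 3 ≤ 1.2 := by
      rw [Real.log_le_iff_le_exp (by norm_num)]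
      have h1 := Real.exp_one_gt_d9
      have h2 := Real.add_one_le_exp (0.2 : ℝ)
      have h3 : Real.exp 1.2 = Real.exp 1 * Real.exp 0.2 := by rw [← Real.exp_add]; norm_num
      rw [h3]; nlinarith
    norm_num at hsharp ⊢
    by_contra hcon
    nlinarith
  · simpa using hchern

/-- The condition `hlog` says that the confidence radius takes at most half of `k m`; Chernoff at `k
m / 2` gives the exponent `(k m / 2)² / (2 k) = k m² / 8`. -/
lemma measureReal_ge_le_of_log_le [IsProbabilityMeasure P] {X : Ω → ℝ} {k : ℕ} (hk : 1 ≤ k)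
    (h : HasSubgaussianMGF X k P) {m : ℝ} (hm : 0 < m)
    (hlog : 16 * Real.log k ≤ k * m ^ 2) :
    P.real {ω | k * m - Real.sqrt (4 * k * Real.log k) ≤ X ω}
      ≤ Real.exp (-(k * (m ^ 2 / 8))) := by
  have hk0 : (0 : ℝ) < k := by exact_mod_cast hk
  have hs : Real.sqrt (4 * k * Real.log k) ≤ k * m / 2 := by
    rw [Real.sqrt_le_left (by positivity)]
    nlinarith
  have h1 := h.measure_ge_le (ε := k * m / 2) (by positivity)
  refine (measureReal_mono fun ω hω => ?_).trans (h1.trans (le_of_eq ?_))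
  · have : k * m - Real.sqrt (4 * k * Real.log k) ≤ X ω := hω
    change k * m / 2 ≤ X ω
    linarith
  · congr 1
    push_cast
    field_simp
    norm_num

end Subgaussian

end LexBandit
namespace LexBandit

/-! ### Measurability with respect to the past, and the first `k` selections of an arm. -/

section History

variable {A D : ℕ} {Ω : Type*} {μ : Fin A → Fin D → ℝ} {η : Fin D → ℝ}
  {act : ℕ → Ω → Fin A} {noise : ℕ → Ω → Fin D → ℝ}

/-- The σ-algebra of the past of round `n` and the arm selected in it. -/
abbrev actSigma (μ : Fin A → Fin D → ℝ) (act : ℕ → Ω → Fin A)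
    (noise : ℕ → Ω → Fin D → ℝ) (n : ℕ) : MeasurableSpace Ω :=
  pastSigma μ act noise n ⊔ MeasurableSpace.comap (act n) inferInstance

lemma measurable_pastSigma_act {n s : ℕ} (hs : s < n) :
    Measurable[pastSigma μ act noise n] (act s) := by
  have h := comap_measurable (m := MeasurableSpace.pi)
    (fun ω => fun s : Fin n => (act s ω, reward μ act noise s ω))
  exact ((measurable_pi_apply (⟨s, hs⟩ : Fin n)).comp h).fst

/-- The past records rewards; subtracting the mean of the selected arm recovers the noise. -/
lemma measurable_pastSigma_noise {n s : ℕ} (hs : s < n) (i : Fin D) :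
    Measurable[pastSigma μ act noise n] (fun ω => noise s ω i) := by
  have h := comap_measurable (m := MeasurableSpace.pi)
    (fun ω => fun s : Fin n => (act s ω, reward μ act noise s ω))
  have h1 : Measurable[pastSigma μ act noise n] (fun ω => reward μ act noise s ω i) :=
    (measurable_pi_apply i).comp ((measurable_pi_apply (⟨s, hs⟩ : Fin n)).comp h).snd
  have h2 : Measurable[pastSigma μ act noise n] (fun ω => μ (act s ω) i) :=
    (measurable_of_countable fun a => μ a i).comp (measurable_pastSigma_act hs)
  have h3 : (fun ω => noise s ω i) = fun ω => reward μ act noise s ω i - μ (act s ω) i := by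
    ext ω; simp [reward]
  rw [h3]
  exact h1.sub h2

lemma measurable_pulls {m : MeasurableSpace Ω} {x : Ω → ℕ → Fin A × (Fin D → ℝ)} {n : ℕ}
    (b : Fin A) (h : ∀ s < n, Measurable[m] fun ω => (x ω s).1) :
    Measurable[m] (fun ω => pulls (x ω) n b) := by
  induction n with
  | zero =>
    simp only [pulls, Finset.range_zero, Finset.filter_empty, Finset.card_empty]
    exact measurable_const
  | succ n ih =>
    simp only [pulls_succ]
    refine (ih fun s hs => h s (by omega)).add ?_
    exact Measurable.ite (h n (by omega) (measurableSet_singleton b)) measurable_const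
      measurable_const

lemma measurable_actSigma_act {n s : ℕ} (hs : s ≤ n) :
    Measurable[actSigma μ act noise n] (act s) := by
  rcases hs.lt_or_eq with h | rfl
  · exact (measurable_pastSigma_act h).mono le_sup_left le_rfl
  · exact (comap_measurable (act s)).mono le_sup_right le_rfl

/-- The event that round `s` is one of the first `k` selections of arm `b`. -/
def pullEvent (act : ℕ → Ω → Fin A) (b : Fin A) (k s : ℕ) : Set Ω :=
  {ω | act s ω = b ∧ pulls (fun n => (act n ω, (0 : Fin 0 → ℝ))) s b < k}

lemma measurableSet_pullEvent (b : Fin A) (k s : ℕ) {m : MeasurableSpace Ω}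
    (h : ∀ r ≤ s, Measurable[m] (act r)) : MeasurableSet[m] (pullEvent act b k s) := by
  have h1 : MeasurableSet[m] {ω | act s ω = b} := h s le_rfl (measurableSet_singleton b)
  have h2 : Measurable[m] (fun ω => pulls (fun n => (act n ω, (0 : Fin 0 → ℝ))) s b) :=
    measurable_pulls b fun r hr => h r hr.le
  exact h1.inter (h2 (measurableSet_Iio (a := k)))

lemma truncSum_shiftedRecord (b : Fin A) (k T : ℕ) (v : ℕ → ℝ) (ω : Ω) :
    truncSum (shiftedRecord μ η act noise ω) b k v T
      = ∑ s ∈ Finset.range T, (pullEvent act b k s).indicator (fun _ => v s) ω := by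
  classical
  simp only [truncSum, Set.indicator_apply]
  refine Finset.sum_congr rfl fun s _ => ?_
  -- Selection counts read only the arms, so the record with empty reward vectors in `pullEvent`
  -- gives the same count by definition.
  have h : ((shiftedRecord μ η act noise ω s).1 = b ∧ pulls (shiftedRecord μ η act noise ω) s b < k)
      ↔ ω ∈ pullEvent act b k s := Iff.rfl
  simp only [h]

lemma sum_indicator_pullEvent_le (b : Fin A) (k T : ℕ) (ω : Ω) :
    ∑ s ∈ Finset.range T, (pullEvent act b k s).indicator (fun _ => (1 : ℝ)) ω ≤ k := by
  classical
  simp only [Set.indicator_apply, Finset.sum_boole]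
  norm_cast
  conv_rhs => rw [← Finset.card_range k]
  refine Finset.card_le_card_of_injOn
    (fun s => pulls (fun n => (act n ω, (0 : Fin 0 → ℝ))) s b) ?_ ?_
  · intro s hs
    simp only [Finset.coe_filter, Set.mem_ofPred_eq] at hs
    simpa using hs.2.2
  · intro s hs t ht hst
    simp only [Finset.coe_filter, Set.mem_ofPred_eq] at hs ht hst
    rcases lt_trichotomy s t with h | h | h
    · exact absurd hst (pulls_lt_of_lt (x := fun n => (act n ω, (0 : Fin 0 → ℝ))) hs.2.1 h).ne
    · exact h
    · exact absurd hst (pulls_lt_of_lt (x := fun n => (act n ω, (0 : Fin 0 → ℝ))) ht.2.1 h).ne'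

/-- The noise in objective `i`, summed over the first `k` selections of arm `b`. -/
noncomputable def truncNoise (act : ℕ → Ω → Fin A) (noise : ℕ → Ω → Fin D → ℝ) (b : Fin A)
    (i : Fin D) (k T : ℕ) (ω : Ω) : ℝ :=
  ∑ s ∈ Finset.range T, (pullEvent act b k s).indicator (fun ω => noise s ω i) ω

end History

/-! ### Concentration of the noise over the first `k` selections. -/

section Noise

variable {A D : ℕ} {Ω : Type*} [mΩ : MeasurableSpace Ω] {P : Measure Ω}
  {μ : Fin A → Fin D → ℝ} {ν : Fin A → Measure (Fin D → ℝ)} {η : Fin D → ℝ}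
  {act : ℕ → Ω → Fin A} {noise : ℕ → Ω → Fin D → ℝ}

lemma measurable_actSigma_le {n : ℕ} (hact : ∀ n, Measurable (act n))
    (hnoise : ∀ n, Measurable (noise n)) : actSigma μ act noise n ≤ mΩ := by
  refine sup_le ?_ (hact n).comap_le
  refine Measurable.comap_le (measurable_pi_lambda _ fun s => (hact s).prodMk ?_)
  refine measurable_pi_lambda _ fun i => ?_
  exact ((measurable_of_countable fun a => μ a i).comp (hact s)).add
    ((measurable_pi_apply i).comp (hnoise s))

/-- On an event known before the noise of the round in which arm `b` is selected,
the noise has distribution `ν b`. -/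
lemma measure_inter_noise [IsProbabilityMeasure P] (hν : ∀ a, IsProbabilityMeasure (ν a))
    (hrun : IsNOMLEXRun P μ ν η act noise) {n : ℕ} {b : Fin A} {C : Set Ω}
    (hC : MeasurableSet[actSigma μ act noise n] C) (hCb : ∀ ω ∈ C, act n ω = b)
    {B : Set (Fin D → ℝ)} (hB : MeasurableSet B) :
    P (C ∩ noise n ⁻¹' B) = P C * ν b B := by
  have hle := measurable_actSigma_le (μ := μ) (n := n) hrun.measurable_act hrun.measurable_noise
  have hB' : MeasurableSet (noise n ⁻¹' B) := hrun.measurable_noise n hB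
  have h1 := setIntegral_condExp hle (μ := P) (f := (noise n ⁻¹' B).indicator (fun _ => (1 : ℝ)))
    ((integrable_const 1).indicator hB') hC
  have h2 : ∫ ω in C, (P[(noise n ⁻¹' B).indicator (fun _ => (1 : ℝ)) | actSigma μ act noise n]) ω ∂P
      = ∫ ω in C, (ν b).real B ∂P := by
    refine setIntegral_congr_ae (hle _ hC) ?_
    filter_upwards [hrun.cond_noise n B hB] with ω hω hωC
    rw [hω, hCb ω hωC]
  rw [h2, setIntegral_const, integral_indicator hB', setIntegral_const,
    measureReal_restrict_apply hB', smul_eq_mul, smul_eq_mul, mul_one] at h1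
  rw [Set.inter_comm]
  rw [← ENNReal.toReal_eq_toReal_iff' (measure_ne_top _ _)
    (ENNReal.mul_ne_top (measure_ne_top _ _) (measure_ne_top _ _)), ENNReal.toReal_mul]
  exact h1.symm

/-- On `C` the joint law of `Z` and the noise is a product: `measure_inter_noise` gives this on
rectangles, which determine the measure. -/
lemma lintegral_mul_noise [IsProbabilityMeasure P] (hν : ∀ a, IsProbabilityMeasure (ν a))
    (hrun : IsNOMLEXRun P μ ν η act noise) {n : ℕ} {b : Fin A} {C : Set Ω}
    (hC : MeasurableSet[actSigma μ act noise n] C) (hCb : ∀ ω ∈ C, act n ω = b)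
    {Z : Ω → ENNReal} (hZ : Measurable[actSigma μ act noise n] Z)
    {g : (Fin D → ℝ) → ENNReal} (hg : Measurable g) :
    ∫⁻ ω in C, Z ω * g (noise n ω) ∂P = (∫⁻ ω in C, Z ω ∂P) * ∫⁻ x, g x ∂(ν b) := by
  have hle := measurable_actSigma_le (μ := μ) (n := n) hrun.measurable_act hrun.measurable_noise
  have hZ' : Measurable Z := hZ.mono hle le_rfl
  have hn := hrun.measurable_noise n
  have hprod : ((P.restrict C).map Z).prod (ν b)
      = (P.restrict C).map (fun ω => (Z ω, noise n ω)) := by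
    refine Measure.prod_eq fun s t hs ht => ?_
    rw [Measure.map_apply (hZ'.prodMk hn) (hs.prod ht), Measure.map_apply hZ' hs,
      Measure.restrict_apply (hZ'.prodMk hn (hs.prod ht)), Measure.restrict_apply (hZ' hs)]
    have hCs : MeasurableSet[actSigma μ act noise n] (Z ⁻¹' s ∩ C) := (hZ hs).inter hC
    rw [← measure_inter_noise hν hrun hCs (fun ω hω => hCb ω hω.2) ht]
    congr 1
    ext ω
    simp only [Set.mem_inter_iff, Set.mem_preimage, Set.mem_prod]
    tauto
  have h1 : ∫⁻ ω in C, Z ω * g (noise n ω) ∂P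
      = ∫⁻ p : ENNReal × (Fin D → ℝ), p.1 * g p.2
          ∂((P.restrict C).map (fun ω => (Z ω, noise n ω))) := by
    rw [lintegral_map (by fun_prop) (hZ'.prodMk hn)]
  rw [h1, ← hprod, lintegral_prod_mul (f := fun z : ENNReal => z) (by fun_prop) hg.aemeasurable,
    lintegral_map measurable_id' hZ']

/-- The exponential process of the truncated noise sums is a supermartingale from `1`. -/
lemma lintegral_exp_truncSum_le [IsProbabilityMeasure P] (hν : ∀ a, IsProbabilityMeasure (ν a))
    (hsub : ∀ (a : Fin A) (i : Fin D), HasSubgaussianMGF (fun x : Fin D → ℝ => x i) 1 (ν a))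
    (hrun : IsNOMLEXRun P μ ν η act noise) (b : Fin A) (i : Fin D) (k : ℕ) (l : ℝ) (T : ℕ) :
    ∫⁻ ω, ENNReal.ofReal (Real.exp (∑ s ∈ Finset.range T,
        (pullEvent act b k s).indicator (fun ω => l * noise s ω i - l ^ 2 / 2) ω)) ∂P ≤ 1 := by
  induction T with
  | zero => simp
  | succ T ih =>
    set C := pullEvent act b k T with hCdef
    set U : Ω → ENNReal := fun ω => ENNReal.ofReal (Real.exp (∑ s ∈ Finset.range T,
        (pullEvent act b k s).indicator (fun ω => l * noise s ω i - l ^ 2 / 2) ω)) with hU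
    have hle := measurable_actSigma_le (μ := μ) (n := T) hrun.measurable_act hrun.measurable_noise
    have hC : MeasurableSet[actSigma μ act noise T] C :=
      measurableSet_pullEvent b k T fun r hr => measurable_actSigma_act hr
    have hUm : Measurable[actSigma μ act noise T] U := by
      refine ENNReal.measurable_ofReal.comp (Real.measurable_exp.comp ?_)
      refine Finset.measurable_fun_sum _ fun s hs => ?_
      have hs' : s < T := Finset.mem_range.1 hs
      refine Measurable.indicator ?_ (measurableSet_pullEvent b k s fun r hr =>
        measurable_actSigma_act (hr.trans hs'.le))
      have := (measurable_pastSigma_noise (μ := μ) (act := act) (noise := noise) hs' i).mono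
        (le_sup_left : pastSigma μ act noise T ≤ actSigma μ act noise T) le_rfl
      exact (this.const_mul l).sub measurable_const
    set g : (Fin D → ℝ) → ENNReal := fun y => ENNReal.ofReal (Real.exp (l * y i - l ^ 2 / 2))
      with hg
    have hgm : Measurable g := by fun_prop
    have hgint : ∫⁻ y, g y ∂(ν b) ≤ 1 := by
      have h1 := (hsub b i).integrable_exp_mul l
      have h2 : ∀ y : Fin D → ℝ, Real.exp (l * y i - l ^ 2 / 2)
          = Real.exp (l * y i) * Real.exp (-(l ^ 2 / 2)) := fun y => by
        rw [← Real.exp_add, sub_eq_add_neg]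
      have h3 : Integrable (fun y : Fin D → ℝ => Real.exp (l * y i - l ^ 2 / 2)) (ν b) := by
        simp only [h2]; exact h1.mul_const _
      rw [hg, ← ofReal_integral_eq_lintegral_ofReal h3
        (Filter.Eventually.of_forall fun y => (Real.exp_pos _).le), ENNReal.ofReal_le_one]
      simp only [h2]
      rw [integral_mul_const]
      have h4 := (hsub b i).mgf_le l
      rw [mgf] at h4
      calc _ ≤ Real.exp ((1 : NNReal) * l ^ 2 / 2) * Real.exp (-(l ^ 2 / 2)) :=
            mul_le_mul_of_nonneg_right h4 (Real.exp_pos _).le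
        _ = 1 := by rw [← Real.exp_add]; simp
    have hstep : ∀ ω, ENNReal.ofReal (Real.exp (∑ s ∈ Finset.range (T + 1),
        (pullEvent act b k s).indicator (fun ω => l * noise s ω i - l ^ 2 / 2) ω))
        = U ω * ENNReal.ofReal (Real.exp (C.indicator
          (fun ω => l * noise T ω i - l ^ 2 / 2) ω)) := fun ω => by
      rw [Finset.sum_range_succ, Real.exp_add, ENNReal.ofReal_mul (Real.exp_pos _).le]
    simp only [hstep]
    -- On `C` the new factor is independent of `U` and has mean at most 1 under `ν b`; off `C` it is
    -- 1.
    rw [← lintegral_add_compl _ (hle _ hC)]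
    have e1 : ∫⁻ ω in C, U ω * ENNReal.ofReal (Real.exp (C.indicator
          (fun ω => l * noise T ω i - l ^ 2 / 2) ω)) ∂P = ∫⁻ ω in C, U ω * g (noise T ω) ∂P := by
      refine setLIntegral_congr_fun (hle _ hC) fun ω hω => ?_
      simp only [Set.indicator_of_mem hω, hg]
    have e2 : ∫⁻ ω in Cᶜ, U ω * ENNReal.ofReal (Real.exp (C.indicator
          (fun ω => l * noise T ω i - l ^ 2 / 2) ω)) ∂P = ∫⁻ ω in Cᶜ, U ω ∂P := by
      refine setLIntegral_congr_fun (hle _ hC).compl fun ω hω => ?_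
      simp only [Set.indicator_of_notMem hω, Real.exp_zero, ENNReal.ofReal_one, mul_one]
    rw [e1, e2, lintegral_mul_noise hν hrun hC (fun ω hω => hω.1) hUm hgm]
    calc _ ≤ (∫⁻ ω in C, U ω ∂P) * 1 + ∫⁻ ω in Cᶜ, U ω ∂P := by gcongr
      _ = ∫⁻ ω, U ω ∂P := by rw [mul_one, lintegral_add_compl _ (hle _ hC)]
      _ ≤ 1 := ih

lemma measurable_truncNoise (hrun : IsNOMLEXRun P μ ν η act noise) (b : Fin A)
    (i : Fin D) (k T : ℕ) : Measurable (truncNoise act noise b i k T) := by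
  refine Finset.measurable_fun_sum _ fun s _ => ?_
  exact ((measurable_pi_apply i).comp (hrun.measurable_noise s)).indicator
    (measurableSet_pullEvent b k s fun r _ => hrun.measurable_act r)

/-- At most `k` rounds contribute, so the compensator `l²/2` per contributing round totals at most
`k l²/2`, however many rounds pass. -/
lemma hasSubgaussianMGF_truncNoise [IsProbabilityMeasure P]
    (hν : ∀ a, IsProbabilityMeasure (ν a))
    (hsub : ∀ (a : Fin A) (i : Fin D), HasSubgaussianMGF (fun x : Fin D → ℝ => x i) 1 (ν a))
    (hrun : IsNOMLEXRun P μ ν η act noise) (b : Fin A) (i : Fin D) (k T : ℕ) :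
    HasSubgaussianMGF (truncNoise act noise b i k T) k P := by
  have hm := measurable_truncNoise hrun b i k T
  have key : ∀ l : ℝ, ∫⁻ ω, ENNReal.ofReal (Real.exp (l * truncNoise act noise b i k T ω)) ∂P
      ≤ ENNReal.ofReal (Real.exp (k * l ^ 2 / 2)) := by
    intro l
    calc _ ≤ ∫⁻ ω, ENNReal.ofReal (Real.exp (k * l ^ 2 / 2)) *
          ENNReal.ofReal (Real.exp (∑ s ∈ Finset.range T,
            (pullEvent act b k s).indicator (fun ω => l * noise s ω i - l ^ 2 / 2) ω)) ∂P := by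
          refine lintegral_mono fun ω => ?_
          rw [← ENNReal.ofReal_mul (Real.exp_pos _).le, ← Real.exp_add]
          refine ENNReal.ofReal_le_ofReal (Real.exp_le_exp.2 ?_)
          have h1 : ∑ s ∈ Finset.range T,
              (pullEvent act b k s).indicator (fun ω => l * noise s ω i - l ^ 2 / 2) ω
              = l * truncNoise act noise b i k T ω - l ^ 2 / 2 * ∑ s ∈ Finset.range T,
                (pullEvent act b k s).indicator (fun _ => (1 : ℝ)) ω := by
            rw [truncNoise, Finset.mul_sum, Finset.mul_sum, ← Finset.sum_sub_distrib]
            refine Finset.sum_congr rfl fun s _ => ?_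
            by_cases h : ω ∈ pullEvent act b k s <;> simp [h]
          have h2 := sum_indicator_pullEvent_le (act := act) b k T ω
          rw [h1]
          nlinarith [sq_nonneg l]
      _ ≤ ENNReal.ofReal (Real.exp (k * l ^ 2 / 2)) * 1 := by
          rw [lintegral_const_mul' _ _ ENNReal.ofReal_ne_top]
          gcongr
          exact lintegral_exp_truncSum_le hν hsub hrun b i k l T
      _ = _ := mul_one _
  have hae : ∀ l : ℝ, AEStronglyMeasurable
      (fun ω => Real.exp (l * truncNoise act noise b i k T ω)) P := fun l =>
    (Real.measurable_exp.comp (hm.const_mul l)).aestronglyMeasurable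
  constructor
  · intro l
    refine ⟨hae l, ?_⟩
    rw [hasFiniteIntegral_iff_ofReal (Filter.Eventually.of_forall fun ω => (Real.exp_pos _).le)]
    exact (key l).trans_lt ENNReal.ofReal_lt_top
  · intro l
    rw [mgf, integral_eq_lintegral_of_nonneg_ae
      (Filter.Eventually.of_forall fun ω => (Real.exp_pos _).le) (hae l)]
    exact ENNReal.toReal_le_of_le_ofReal (Real.exp_pos _).le (by simpa using key l)

/-- Almost surely, the algorithm only selects arms with positive selection probability. -/
lemma ae_selectProb_ne_zero [IsProbabilityMeasure P] (hrun : IsNOMLEXRun P μ ν η act noise) :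
    ∀ᵐ ω ∂P, ∀ n, selectProb (shiftedRecord μ η act noise ω) n (act n ω) ≠ 0 := by
  rw [ae_all_iff]
  intro n
  have hall : ∀ᵐ ω ∂P, ∀ b, act n ω = b →
      selectProb (shiftedRecord μ η act noise ω) n b ≠ 0 := by
    rw [ae_all_iff]
    intro b
    have hle : pastSigma μ act noise n ≤ mΩ := le_sup_left.trans
      (measurable_actSigma_le (μ := μ) (n := n) hrun.measurable_act hrun.measurable_noise)
    set f : Ω → ℝ := (act n ⁻¹' {b}).indicator (fun _ => (1 : ℝ)) with hf
    have hb : MeasurableSet (act n ⁻¹' {b}) := hrun.measurable_act n (measurableSet_singleton b)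
    have hfi : Integrable f P := (integrable_const 1).indicator hb
    set h := P[f | pastSigma μ act noise n]
    -- The event of zero conditional probability belongs to the past, so integrating the conditional
    -- expectation over it shows that `b` is almost never selected there.
    have hS : MeasurableSet[pastSigma μ act noise n] (h ⁻¹' {0}) :=
      stronglyMeasurable_condExp.measurable (measurableSet_singleton 0)
    have h1 := setIntegral_condExp hle hfi hS
    have h2 : ∫ ω in h ⁻¹' {0}, h ω ∂P = 0 := by
      rw [setIntegral_congr_fun (g := fun _ => (0 : ℝ)) (hle _ hS) fun ω hω => hω]
      simp
    have h3 : ∫ ω in h ⁻¹' {0}, f ω ∂P = 0 := h1.symm.trans h2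
    rw [integral_eq_zero_iff_of_nonneg
      (fun ω => Set.indicator_nonneg (fun _ _ => zero_le_one) ω) hfi.restrict] at h3
    have h4 := (ae_restrict_iff' (hle _ hS)).1 h3
    filter_upwards [h4, hrun.cond_act n b] with ω hω1 hω2 hωb h0
    have := hω1 (show h ω = 0 from hω2.trans h0)
    simp [hωb] at this
  filter_upwards [hall] with ω hω
  exact hω _ rfl

end Noise

end LexBandit
namespace LexBandit

/-! ### From selection counts to deviation events and regret. -/

section Regret

variable {A D : ℕ} {Ω : Type*} {μ : Fin A → Fin D → ℝ} {η : Fin D → ℝ}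
  {act : ℕ → Ω → Fin A} {noise : ℕ → Ω → Fin D → ℝ}

lemma truncSum_shiftedRecord_noise (b : Fin A) (i : Fin D) (k T : ℕ) (ω : Ω) :
    truncSum (shiftedRecord μ η act noise ω) b k (fun s => noise s ω i) T
      = truncNoise act noise b i k T ω := by
  rw [truncSum_shiftedRecord, truncNoise]
  refine Finset.sum_congr rfl fun s _ => ?_
  by_cases h : ω ∈ pullEvent act b k s <;> simp [h]

lemma sampleMean_shiftedRecord {t T : ℕ} (htT : t ≤ T) (b : Fin A) (i : Fin D) (ω : Ω)
    (hpos : 1 ≤ pulls (shiftedRecord μ η act noise ω) t b) :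
    sampleMean (shiftedRecord μ η act noise ω) t b i
      = (μ b i - η i) + truncNoise act noise b i
          (pulls (shiftedRecord μ η act noise ω) t b) T ω
          / (pulls (shiftedRecord μ η act noise ω) t b : ℝ) := by
  rw [← truncSum_shiftedRecord_noise (μ := μ) (η := η)]
  refine sampleMean_eq htT b i _ _ (fun s hs => ?_) hpos
  have hs' : act s ω = b := hs
  simp only [shiftedRecord, reward, hs']
  ring

lemma mul_sqrt_log_div {k : ℕ} (hk : 1 ≤ k) :
    Real.sqrt (4 * Real.log k / k) * k = Real.sqrt (4 * k * Real.log k) := by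
  have hk0 : (0 : ℝ) < k := by exact_mod_cast hk
  conv_lhs => rw [← Real.sqrt_sq hk0.le]
  rw [← Real.sqrt_mul' _ (sq_nonneg _)]
  congr 1
  rw [Real.sqrt_sq hk0.le]
  field_simp

-- Rejection of `star` and acceptance of `b`, multiplied by the selection count, become deviations
-- of noise sums with deterministic `k`; the objective in which `star` fails is handled by a sum
-- over all objectives.
open Classical in
lemma pulls_le_sum_indicator_truncNoise {star b : Fin A} {j : Fin D} {m : ℝ} {ω : Ω}
    (hstar : ∀ i, 0 ≤ μ star i - η i) (hb : μ b j - η j ≤ -m)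
    (hω : ∀ n, selectProb (shiftedRecord μ η act noise ω) n (act n ω) ≠ 0) (T : ℕ) :
    (pulls (shiftedRecord μ η act noise ω) T b : ℝ)
      ≤ 1 + (∑ k ∈ Finset.Icc 1 T, ∑ i, {ω | truncNoise act noise star i k T ω
            ≤ -Real.sqrt (4 * k * Real.log k)}.indicator (fun _ => (1 : ℝ)) ω)
        + ∑ k ∈ Finset.Icc 1 T, {ω | k * m - Real.sqrt (4 * k * Real.log k)
            ≤ truncNoise act noise b j k T ω}.indicator (fun _ => (1 : ℝ)) ω := by
  set x := shiftedRecord μ η act noise ω with hx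
  have h := pulls_le_sum_indicator (x := x) hω T b star
    (fun k => ∃ i, truncNoise act noise star i k T ω ≤ -Real.sqrt (4 * k * Real.log k))
    (fun k => k * m - Real.sqrt (4 * k * Real.log k) ≤ truncNoise act noise b j k T ω) ?_ ?_
  · calc (pulls x T b : ℝ) ≤ ((1 + (∑ k ∈ Finset.Icc 1 T, if ∃ i,
            truncNoise act noise star i k T ω ≤ -Real.sqrt (4 * k * Real.log k) then 1 else 0)
          + ∑ k ∈ Finset.Icc 1 T, if k * m - Real.sqrt (4 * k * Real.log k)
            ≤ truncNoise act noise b j k T ω then 1 else 0 : ℕ) : ℝ) := by exact_mod_cast h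
      _ ≤ _ := by
        push_cast
        refine add_le_add (add_le_add_right (Finset.sum_le_sum fun k _ => ?_) _)
          (Finset.sum_le_sum fun k _ => ?_)
        · split_ifs with hi
          · obtain ⟨i, hi⟩ := hi
            have := Finset.single_le_sum (f := fun i => {ω | truncNoise act noise star i k T ω
              ≤ -Real.sqrt (4 * k * Real.log k)}.indicator (fun _ => (1 : ℝ)) ω)
              (fun i _ => Set.indicator_nonneg (fun _ _ => zero_le_one (α := ℝ)) ω) (Finset.mem_univ i)
            refine le_trans (le_of_eq ?_) this
            exact (Set.indicator_of_mem (s := {ω | truncNoise act noise star i k T ω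
              ≤ -Real.sqrt (4 * k * Real.log k)}) hi (fun _ => (1 : ℝ))).symm
          · exact Finset.sum_nonneg fun i _ => Set.indicator_nonneg (fun _ _ => zero_le_one (α := ℝ)) ω
        · simp [Set.indicator_apply]
  · intro t ht h1 hmem
    have hk0 : (0 : ℝ) < pulls x t star := by exact_mod_cast h1
    simp only [estArms, Finset.mem_filter, Finset.mem_univ, true_and, not_forall, not_lt] at hmem
    obtain ⟨i, hi⟩ := hmem
    refine ⟨i, ?_⟩
    rw [sampleMean_shiftedRecord ht.le star i ω h1] at hi
    have h2 : truncNoise act noise star i (pulls x t star) T ω / (pulls x t star : ℝ)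
        ≤ -Real.sqrt (4 * Real.log (pulls x t star) / (pulls x t star)) := by
      linarith [hstar i]
    rw [div_le_iff₀ hk0, neg_mul, mul_sqrt_log_div h1] at h2
    exact h2
  · intro t ht h1 hmem
    have hk0 : (0 : ℝ) < pulls x t b := by exact_mod_cast h1
    simp only [estArms, Finset.mem_filter, Finset.mem_univ, true_and] at hmem
    have hi := hmem j
    rw [sampleMean_shiftedRecord ht.le b j ω h1] at hi
    have h2 : m - Real.sqrt (4 * Real.log (pulls x t b) / (pulls x t b))
        ≤ truncNoise act noise b j (pulls x t b) T ω / (pulls x t b : ℝ) := by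
      linarith
    rw [le_div_iff₀ hk0, sub_mul, mul_sqrt_log_div h1, mul_comm] at h2
    exact h2

lemma priorityFreeRegret_eq (star : Fin A) (i : Fin D) (T : ℕ) (ω : Ω) :
    priorityFreeRegret μ star act i T ω
      = ∑ a, gap μ star a i * (pulls (shiftedRecord μ η act noise ω) T a : ℝ) := by
  classical
  have h : ∀ a, (pulls (shiftedRecord μ η act noise ω) T a : ℝ)
      = ∑ n ∈ Finset.range T, if act n ω = a then 1 else 0 := fun a => by
    rw [Finset.sum_boole]
    simp only [pulls, shiftedRecord]
    congr!
  simp only [priorityFreeRegret, h, Finset.mul_sum]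
  rw [Finset.sum_comm]
  refine Finset.sum_congr rfl fun n _ => ?_
  simp

/-- Arms outside `suboptArms` have nonpositive gaps, so discarding them can only increase the sum.
-/
lemma priorityFreeRegret_le (star : Fin A) (i : Fin D) (T : ℕ) (ω : Ω) :
    priorityFreeRegret μ star act i T ω
      ≤ ∑ a ∈ suboptArms μ star i,
        gap μ star a i * (pulls (shiftedRecord μ η act noise ω) T a : ℝ) := by
  classical
  rw [priorityFreeRegret_eq (η := η) (noise := noise), suboptArms,
    ← Finset.sum_filter_add_sum_filter_not Finset.univ (fun a => 0 < gap μ star a i)]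
  refine add_le_of_nonpos_right (Finset.sum_nonpos fun a ha => ?_)
  exact mul_nonpos_of_nonpos_of_nonneg (not_lt.1 (Finset.mem_filter.1 ha).2) (Nat.cast_nonneg _)

lemma lt_of_mem_suboptArms {star a : Fin A} {i : Fin D}
    (hη : (μ star i : EReal) - minGap μ star i < (η i : EReal)) (ha : a ∈ suboptArms μ star i) :
    μ a i < η i := by
  have h1 : minGap μ star i ≤ (gap μ star a i : EReal) := iInf₂_le a ha
  have h2 : (μ star i : EReal) - (gap μ star a i : EReal) < (η i : EReal) :=
    (EReal.sub_le_sub le_rfl h1).trans_lt hη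
  rw [← EReal.coe_sub, EReal.coe_lt_coe_iff] at h2
  simpa [gap] using h2

end Regret

/-! ### The expected number of selections of a suboptimal arm. -/

section Expectation

variable {A D : ℕ} {Ω : Type*} [mΩ : MeasurableSpace Ω] {P : Measure Ω}
  {μ : Fin A → Fin D → ℝ} {ν : Fin A → Measure (Fin D → ℝ)} {η : Fin D → ℝ}
  {act : ℕ → Ω → Fin A} {noise : ℕ → Ω → Fin D → ℝ}

lemma measurable_pulls_shiftedRecord (hrun : IsNOMLEXRun P μ ν η act noise) (T : ℕ) (b : Fin A) :
    Measurable fun ω => (pulls (shiftedRecord μ η act noise ω) T b : ℝ) :=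
  (measurable_of_countable (fun n : ℕ => (n : ℝ))).comp
    (measurable_pulls b fun s _ => hrun.measurable_act s)

lemma integrable_pulls [IsProbabilityMeasure P] (hrun : IsNOMLEXRun P μ ν η act noise) (T : ℕ)
    (b : Fin A) : Integrable (fun ω => (pulls (shiftedRecord μ η act noise ω) T b : ℝ)) P := by
  refine Integrable.of_bound (measurable_pulls_shiftedRecord hrun T b).aestronglyMeasurable T
    (Filter.Eventually.of_forall fun ω => ?_)
  rw [Real.norm_natCast]
  exact_mod_cast pulls_le _ _ _

/-- The expected number of selections of an arm whose expected reward in some objective is at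
least `m` below the known threshold. -/
theorem integral_pulls_le [IsProbabilityMeasure P] (hν : ∀ a, IsProbabilityMeasure (ν a))
    (hsub : ∀ (a : Fin A) (i : Fin D), HasSubgaussianMGF (fun x : Fin D → ℝ => x i) 1 (ν a))
    (hrun : IsNOMLEXRun P μ ν η act noise) {star b : Fin A} {j : Fin D} {m : ℝ}
    (hstar : ∀ i, 0 ≤ μ star i - η i) (hm : 0 < m) (hb : μ b j - η j ≤ -m) (T : ℕ) :
    ∫ ω, (pulls (shiftedRecord μ η act noise ω) T b : ℝ) ∂P
      ≤ Real.pi ^ 2 / 6 * D + 1 + 36 / m ^ 2 * Real.log (17 / m) := by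
  set S : Fin D → ℕ → Set Ω := fun i k =>
    {ω | truncNoise act noise star i k T ω ≤ -Real.sqrt (4 * k * Real.log k)} with hS
  set B : ℕ → Set Ω := fun k =>
    {ω | k * m - Real.sqrt (4 * k * Real.log k) ≤ truncNoise act noise b j k T ω} with hB
  have hSm : ∀ i k, MeasurableSet (S i k) := fun i k =>
    measurableSet_le (measurable_truncNoise hrun star i k T) measurable_const
  have hBm : ∀ k, MeasurableSet (B k) := fun k =>
    measurableSet_le measurable_const (measurable_truncNoise hrun b j k T)
  have hSi : ∀ i k, Integrable ((S i k).indicator fun _ => (1 : ℝ)) P := fun i k =>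
    (integrable_const 1).indicator (hSm i k)
  have hBi : ∀ k, Integrable ((B k).indicator fun _ => (1 : ℝ)) P := fun k =>
    (integrable_const 1).indicator (hBm k)
  have hi1 : Integrable (fun ω => ∑ k ∈ Finset.Icc 1 T, ∑ i,
      (S i k).indicator (fun _ => (1 : ℝ)) ω) P :=
    integrable_finsetSum _ fun k _ => integrable_finsetSum _ fun i _ => hSi i k
  have hi2 : Integrable (fun ω => ∑ k ∈ Finset.Icc 1 T,
      (B k).indicator (fun _ => (1 : ℝ)) ω) P :=
    integrable_finsetSum _ fun k _ => hBi k
  have hi0 : Integrable (fun ω => 1 + ∑ k ∈ Finset.Icc 1 T, ∑ i,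
      (S i k).indicator (fun _ => (1 : ℝ)) ω) P := (integrable_const 1).add hi1
  -- One objective suffices for the saving `0.026 D` to absorb the excess 0.026 in `sum_tail_le`.
  have hD : (1 : ℝ) ≤ D := by exact_mod_cast j.pos
  have hsum : ∫ ω, (pulls (shiftedRecord μ η act noise ω) T b : ℝ) ∂P
      ≤ 1 + (∑ k ∈ Finset.Icc 1 T, ∑ i, P.real (S i k)) + ∑ k ∈ Finset.Icc 1 T, P.real (B k) := by
    refine (integral_mono_ae (integrable_pulls hrun T b) (hi0.add hi2) ?_).trans (le_of_eq ?_)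
    · filter_upwards [ae_selectProb_ne_zero hrun] with ω hω
      exact pulls_le_sum_indicator_truncNoise hstar hb hω T
    · rw [integral_add' hi0 hi2, integral_add (integrable_const 1) hi1,
        integral_finsetSum _ fun k _ => integrable_finsetSum _ fun i _ => hSi i k,
        integral_finsetSum _ fun k _ => hBi k]
      simp only [integral_finsetSum _ fun i _ => hSi i _, integral_indicator_const _ (hSm _ _),
        integral_indicator_const _ (hBm _), smul_eq_mul, mul_one, integral_const,
        probReal_univ]
  have h1 : ∑ k ∈ Finset.Icc 1 T, ∑ i, P.real (S i k) ≤ D * (Real.pi ^ 2 / 6 - 0.026) := by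
    calc _ ≤ ∑ k ∈ Finset.Icc 1 T, (D : ℝ) * (1 / (k : ℝ) ^ 2 - tailGain k) := by
          refine Finset.sum_le_sum fun k hk => ?_
          refine (Finset.sum_le_card_nsmul _ _ _ fun i _ => measureReal_le_neg_sqrt_le
            (Finset.mem_Icc.1 hk).1
            (hasSubgaussianMGF_truncNoise hν hsub hrun star i k T)).trans (le_of_eq ?_)
          simp
      _ ≤ _ := by
          rw [← Finset.mul_sum]
          exact mul_le_mul_of_nonneg_left (sum_inv_sq_sub_tailGain_le T) (by linarith)
  have h2 := sum_tail_le hm T (fun k => P.real (B k)) (fun k => measureReal_le_one)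
    fun k hk hlog => measureReal_ge_le_of_log_le hk
      (hasSubgaussianMGF_truncNoise hν hsub hrun b j k T) hm hlog
  linarith

end Expectation

end LexBandit

/-! ### The regret bound. -/

open MeasureTheory ProbabilityTheory LexBandit in
theorem mainTheorem6 {A D : ℕ} {Ω : Type*} [MeasurableSpace Ω]
    (P : Measure Ω) [IsProbabilityMeasure P]
    (μ : Fin A → Fin D → ℝ)
    (ν : Fin A → Measure (Fin D → ℝ)) (hν : ∀ a, IsProbabilityMeasure (ν a))
    (hmean : ∀ (a : Fin A) (i : Fin D), ∫ x, x i ∂(ν a) = 0)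
    (hsub : ∀ (a : Fin A) (i : Fin D), HasSubgaussianMGF (fun x : Fin D → ℝ => x i) 1 (ν a))
    (star : Fin A) (hstar : star ∈ LexBandit.lexOptArms μ D)
    (η : Fin D → ℝ)
    (hη : ∀ i : Fin D, (μ star i : EReal) - LexBandit.minGap μ star i < (η i : EReal) ∧
      η i < μ star i)
    (act : ℕ → Ω → Fin A) (noise : ℕ → Ω → Fin D → ℝ)
    (hrun : LexBandit.IsNOMLEXRun P μ ν η act noise)
    (i : Fin D) (T : ℕ) (hT : 1 ≤ T) :
    ∫ ω, LexBandit.priorityFreeRegret μ star act i T ω ∂P ≤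
      ∑ a ∈ LexBandit.suboptArms μ star i,
        ((Real.pi ^ 2 / 6 * (D : ℝ) + 1) * LexBandit.gap μ star a i +
          36 * LexBandit.gap μ star a i / (LexBandit.maxExcess μ star η a) ^ 2 *
            Real.log (17 / LexBandit.maxExcess μ star η a)) := by
  have hpi : ∀ a, Integrable (fun ω => gap μ star a i *
      (pulls (shiftedRecord μ η act noise ω) T a : ℝ)) P := fun a =>
    (integrable_pulls hrun T a).const_mul _
  have hreg : Integrable (fun ω => priorityFreeRegret μ star act i T ω) P := by
    simp only [priorityFreeRegret_eq (η := η) (noise := noise)]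
    exact integrable_finsetSum _ fun a _ => hpi a
  calc ∫ ω, priorityFreeRegret μ star act i T ω ∂P
      ≤ ∫ ω, ∑ a ∈ suboptArms μ star i, gap μ star a i *
          (pulls (shiftedRecord μ η act noise ω) T a : ℝ) ∂P :=
        integral_mono hreg (integrable_finsetSum _ fun a _ => hpi a)
          fun ω => priorityFreeRegret_le star i T ω
    _ = ∑ a ∈ suboptArms μ star i, gap μ star a i *
          ∫ ω, (pulls (shiftedRecord μ η act noise ω) T a : ℝ) ∂P := by
        rw [integral_finsetSum _ fun a _ => hpi a]
        simp only [integral_const_mul]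
    _ ≤ _ := by
        refine Finset.sum_le_sum fun a ha => ?_
        have hgap : 0 < gap μ star a i := by
          simpa [suboptArms] using ha
        have : Nonempty (Fin D) := ⟨i⟩
        obtain ⟨j, hj⟩ := exists_eq_ciSup_of_finite
          (f := fun j : Fin D => gap μ star a j - slack μ star η j)
        have hmj : maxExcess μ star η a = η j - μ a j := by
          rw [maxExcess, ← hj, gap, slack]; ring
        -- Objective `i` itself has positive excess, because `η i` separates `star` from every arm
        -- suboptimal in `i`.
        have hm : 0 < maxExcess μ star η a := by
          have h1 : gap μ star a i - slack μ star η i ≤ maxExcess μ star η a :=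
            le_ciSup (f := fun j : Fin D => gap μ star a j - slack μ star η j)
              (Set.finite_range _).bddAbove i
          have h2 := lt_of_mem_suboptArms (hη i).1 ha
          simp only [gap, slack] at h1
          linarith
        have h := integral_pulls_le hν hsub hrun (star := star) (b := a) (j := j)
          (fun i => sub_nonneg.2 (hη i).2.le) hm (by linarith) T
        calc _ ≤ gap μ star a i * _ := mul_le_mul_of_nonneg_left h hgap.le
          _ = _ := by ring
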